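/- Let $k, n$ be positive integers with $k \ge 2$, and let $m$ be a positive integer or $m = \infty$. A $k$-multiset of $[n]_m$ is a multiset of $k$ elements (counted with repetition) of $[n] = \{1, \dots, n\}$ in which each element occurs at most $m$ times (arbitrarily often if $m = \infty$). Let $\binom{[n]_m}{k}$ be the set of all of them, and put $\lceil k/\infty \rceil := 1$. A family $\mathcal{A} \subseteq \binom{[n]_m}{k}$ is called intersecting if $|A_1 \cap A_2| \ge 1$ for all $A_1, A_2 \in \mathcal{A}$. Two families $\mathcal{A}_1, \mathcal{A}_2$ are called isomorphic, written $\mathcal{A}_1 \cong \mathcal{A}_2$, if $\mathcal{A}_2 = \{\sigma(A) : A \in \mathcal{A}_1\}$ for some permutation $\sigma$ of $[n]$. Let $\mathcal{F}_{0,1}^{(m)} = \{A \in \binom{[n]_m}{k} : |A \cap \{1\}| \ge 1\}$ be the star of all $k$-multisets of $[n]_m$ that contain the element $1$. Suppose that $n \ge k + \lceil k/m \rceil$ and that $\mathcal{A} \subseteq \binom{[n]_m}{k}$ is an intersecting family. Then $|\mathcal{A}| \le |\mathcal{F}_{0,1}^{(m)}|$. Moreover, if (a) $n > k + \lceil k/m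 \rceil$, or (b) $n = k + \lceil k/m \rceil$, $k > m$ and $m \nmid k$, then $|\mathcal{A}| = |\mathcal{F}_{0,1}^{(m)}|$ if and only if $\mathcal{A} \cong \mathcal{F}_{0,1}^{(m)}$. -/

import Mathlib

namespace MultisetEKR

/-- The `k`-multisets of `[n]_m`: multisets of cardinality `k` (with repetitions) on the ground set
`[n]`, modelled by `Fin n`, in which every element occurs at most `m` times.
The value `m = ⊤` is the unbounded case. -/
def kMultisets (n : ℕ) (m : ℕ∞) (k : ℕ) : Finset (Multiset (Fin n)) :=
  (Finset.univ.image (fun s : Sym (Fin n) k => (s : Multiset (Fin n)))).filter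
    (fun A => ∀ i, (A.count i : ℕ∞) ≤ m)

theorem mem_kMultisets {n : ℕ} {m : ℕ∞} {k : ℕ} {A : Multiset (Fin n)} :
    A ∈ kMultisets n m k ↔ A.card = k ∧ ∀ i, (A.count i : ℕ∞) ≤ m := by
  simp only [kMultisets, Finset.mem_filter, Finset.mem_image, Finset.mem_univ, true_and]
  refine and_congr_left fun _ => ⟨?_, fun h => ⟨⟨A, h⟩, rfl⟩⟩
  rintro ⟨B, rfl⟩
  exact B.2

/-- The initial segment consisting of the first `r` elements of the ground set, each taken once. -/
def initSeg (n r : ℕ) : Multiset (Fin n) :=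
  ((Finset.univ : Finset (Fin n)).filter (fun i => i.val < r)).val

/-- The family `F_{s,t}` of the `k`-multisets `A` of `[n]_m` with `|A ∩ [2s+t]| ≥ s + t`.
For `s = 0`, `t = 1` it is the star of the first element. -/
def frankl (n : ℕ) (m : ℕ∞) (k s t : ℕ) : Finset (Multiset (Fin n)) :=
  (kMultisets n m k).filter (fun A => s + t ≤ (A ∩ initSeg n (2 * s + t)).card)

/-- A family is `t`-intersecting if any two of its members (possibly equal) have a multiset
intersection of cardinality at least `t`. -/
def IsTIntersecting {n : ℕ} (t : ℕ) (𝒜 : Finset (Multiset (Fin n))) : Prop :=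
  ∀ A₁ ∈ 𝒜, ∀ A₂ ∈ 𝒜, t ≤ (A₁ ∩ A₂).card

/-- Two families are isomorphic if a permutation of the ground set carries one to the other. -/
def Isomorphic {n : ℕ} (𝒜₁ 𝒜₂ : Finset (Multiset (Fin n))) : Prop :=
  ∃ σ : Equiv.Perm (Fin n), 𝒜₂ = 𝒜₁.image (Multiset.map σ)

/-- `⌈k / m⌉`, read as `1` when `m = ∞`. -/
noncomputable def ceilQuot (k : ℕ) (m : ℕ∞) : ℕ :=
  if m = ⊤ then 1 else ⌈(k : ℚ) / (m.toNat : ℚ)⌉₊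

end MultisetEKR

/-!
Replace an intersecting family of multisets by the family `𝓕` of the supports of its members, an
intersecting family of subsets of `[n]`. Exactly `w j` multisets of `[n]_m` of size `k` have a given
support of size `j`, where `w j` is the coefficient of `X ^ k` in `(X + ⋯ + X ^ m) ^ j`, so the
original family has at most `∑ S ∈ 𝓕, w #S` members, with equality for a star.

Put `c = ⌈k / m⌉`, so that `k + c ≤ n`. The weights satisfy `w j ≤ w i` whenever `i ≤ j` and
`i + j = n`. If `a i` and `s i` are the numbers of `i`-sets in `𝓕` and in a star, then
`a i + a j ≤ s i + s j`, because `𝓕` contains at most one of a set and its complement, and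
`a i ≤ s i` by the Erdős–Ko–Rado theorem. Hence `a i * w i + a j * w j ≤ s i * w i + s j * w j`,
and summing over the pairs of complementary levels gives the bound.

In the cases (a) and (b), `w (n - c) < w c`, so equality forces `a c = s c`. By Katona's circle
method the `c`-sets in `𝓕` are then all those through some point `y`. A support has at most `k`
elements, so if it missed `y` it would be disjoint from one of these `c`-sets.
-/

open Finset Polynomial

namespace MultisetEKR

/-! ### Coefficients of powers of `X + ⋯ + X ^ m` -/

/-- The generating polynomial `X + ⋯ + X ^ m` of a part of size between `1` and `m`: the coefficient
of `X ^ k` in its `j`-th power counts the compositions of `k` into `j` parts of size at most `m`. -/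
noncomputable def partPoly (m : ℕ) : ℕ[X] := ∑ r ∈ range m, X ^ (r + 1)

theorem partPoly_eq_X_mul (m : ℕ) : partPoly m = X * ∑ r ∈ range m, X ^ r := by
  simp only [partPoly, mul_sum, pow_succ']

theorem partPoly_one : partPoly 1 = X := by simp [partPoly]

theorem partPoly_add (M N : ℕ) : partPoly (M + N) = partPoly M + X ^ M * partPoly N := by
  simp only [partPoly, sum_range_add, mul_sum, ← pow_add, add_assoc]

theorem coeff_partPoly (m k : ℕ) : (partPoly m).coeff k = if k ∈ Icc 1 m then 1 else 0 := by
  rcases k with _ | k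
  · simp [partPoly]
  · simp only [partPoly, finsetSum_coeff, coeff_X_pow, add_left_inj, sum_ite_eq, mem_range,
      mem_Icc, Nat.le_add_left, true_and, Nat.lt_iff_add_one_le]

theorem coeff_partPoly_mul_pow_eq_zero {M m j k : ℕ} (h : k ≤ j) :
    (partPoly M * partPoly m ^ j).coeff k = 0 := by
  rw [partPoly_eq_X_mul M, partPoly_eq_X_mul m, mul_pow, mul_mul_mul_comm, ← pow_succ',
    coeff_X_pow_mul', if_neg (by omega)]

theorem coeff_partPoly_pow_eq_zero {m j k : ℕ} (h : k < j) : (partPoly m ^ j).coeff k = 0 := by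
  obtain ⟨j, rfl⟩ : ∃ i, j = i + 1 := ⟨j - 1, by omega⟩
  rw [pow_succ', coeff_partPoly_mul_pow_eq_zero (by omega)]

theorem coeff_partPoly_mul_pow_succ_self_le_one (M m j : ℕ) :
    (partPoly M * partPoly m ^ j).coeff (j + 1) ≤ 1 := by
  have hgeom (m : ℕ) : (∑ r ∈ range m, (X : ℕ[X]) ^ r).coeff 0 ≤ 1 := by
    rcases m with _ | m <;> simp [sum_range_succ']
  rw [partPoly_eq_X_mul M, partPoly_eq_X_mul m, mul_pow, mul_mul_mul_comm, ← pow_succ',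
    coeff_X_pow_mul', if_pos le_rfl, Nat.sub_self, mul_coeff_zero, ← constantCoeff_apply (_ ^ j),
    map_pow, constantCoeff_apply]
  exact mul_le_one' (hgeom M) (pow_le_one' (hgeom m) j)

theorem coeff_partPoly_pow_self_le_one (m k : ℕ) : (partPoly m ^ k).coeff k ≤ 1 := by
  rcases k with _ | k
  · simp
  · simpa only [pow_succ'] using coeff_partPoly_mul_pow_succ_self_le_one m m k

theorem coeff_partPoly_mul_pow_succ (M N j k : ℕ) :
    (partPoly (1 + M) * partPoly (M + N) ^ (j + 1)).coeff (k + 1) =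
      (partPoly M * partPoly (M + N) ^ (j + 1)).coeff k +
      (partPoly M * partPoly (M + N) ^ j).coeff k +
      (X ^ M * (partPoly N * partPoly (M + N) ^ j)).coeff k := by
  have hfirst : partPoly (1 + M) = X * (1 + partPoly M) := by
    rw [partPoly_add, partPoly_one, pow_one, mul_add, mul_one]
  have hsecond : partPoly (M + N) ^ (j + 1) =
      (partPoly M + X ^ M * partPoly N) * partPoly (M + N) ^ j := by
    rw [pow_succ', ← partPoly_add]
  rw [hfirst, mul_assoc, coeff_X_mul, add_mul, one_mul, coeff_add, add_comm, add_assoc]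
  congr 1
  rw [hsecond, add_mul, coeff_add, mul_assoc]

/-- One part is given a smaller bound `M`, so that splitting off its smallest value, as above, turns
the inequality into three instances of itself with smaller `k`. -/
theorem coeff_partPoly_mul_pow_le {m k M q i j : ℕ} (hMm : M ≤ m)
    (hk : k ≤ M + q * m) (hij : i < j) (h : k + q ≤ i + j + 1) :
    (partPoly M * partPoly m ^ j).coeff k ≤ (partPoly M * partPoly m ^ i).coeff k := by
  induction k using Nat.strong_induction_on generalizing M q i j with
  | _ k ih =>
  rcases le_or_gt k j with hkj | hjk
  · simp only [coeff_partPoly_mul_pow_eq_zero hkj, zero_le]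
  obtain ⟨k, rfl⟩ := Nat.exists_eq_add_of_le' (show 1 ≤ k by omega)
  obtain ⟨j, rfl⟩ := Nat.exists_eq_add_of_le' (show 1 ≤ j by omega)
  rcases i with _ | i
  · obtain ⟨rfl, rfl⟩ : q = 0 ∧ k = j + 1 := by omega
    rw [pow_zero, mul_one, coeff_partPoly, if_pos (mem_Icc.2 ⟨by omega, by omega⟩)]
    exact coeff_partPoly_mul_pow_succ_self_le_one M m (j + 1)
  rcases M with _ | M
  · simp [partPoly]
  obtain ⟨N, rfl⟩ := Nat.exists_eq_add_of_le (show M ≤ m by omega)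
  have hshort : (partPoly M * partPoly (M + N) ^ (j + 1)).coeff k ≤
      (partPoly M * partPoly (M + N) ^ i).coeff k :=
    ih k (by omega) (q := q) (by omega) (by omega) (by omega) (by omega)
  have hlong : (partPoly M * partPoly (M + N) ^ j).coeff k ≤
      (partPoly M * partPoly (M + N) ^ (i + 1)).coeff k := by
    rcases (show i + 1 ≤ j by omega).eq_or_lt with rfl | hlt
    · exact le_rfl
    · exact ih k (by omega) (q := q) (by omega) (by omega) hlt (by omega)
  have hshifted : (X ^ M * (partPoly N * partPoly (M + N) ^ j)).coeff k ≤
      (X ^ M * (partPoly N * partPoly (M + N) ^ i)).coeff k := by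
    simp only [coeff_X_pow_mul']
    split_ifs with hMk
    · rcases M.eq_zero_or_pos with rfl | hM
      · obtain ⟨q, rfl⟩ : ∃ p, q = p + 1 := Nat.exists_eq_add_one_of_ne_zero (by rintro rfl; omega)
        rw [add_one_mul] at hk
        exact ih _ (by omega) (q := q) (by omega) (by omega) (by omega) (by omega)
      · exact ih _ (by omega) (q := q) (by omega) (by omega) (by omega) (by omega)
    · exact le_rfl
  rw [add_comm M 1, coeff_partPoly_mul_pow_succ, coeff_partPoly_mul_pow_succ]
  omega

theorem coeff_partPoly_pow_le {m k c i j : ℕ} (hk : k ≤ c * m) (hij : i ≤ j)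
    (h : k + c ≤ i + j) : (partPoly m ^ j).coeff k ≤ (partPoly m ^ i).coeff k := by
  rcases hij.eq_or_lt with rfl | hij
  · exact le_rfl
  rcases lt_or_ge k j with hkj | hjk
  · simp only [coeff_partPoly_pow_eq_zero hkj, zero_le]
  obtain ⟨c, rfl⟩ := Nat.exists_eq_add_one_of_ne_zero (show c ≠ 0 by rintro rfl; omega)
  obtain ⟨i, rfl⟩ := Nat.exists_eq_add_of_le' (show 1 ≤ i by omega)
  obtain ⟨j, rfl⟩ := Nat.exists_eq_add_of_le' (show 1 ≤ j by omega)
  rw [pow_succ', pow_succ']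
  rw [add_one_mul] at hk
  exact coeff_partPoly_mul_pow_le (q := c) le_rfl (by omega) (by omega) (by omega)

theorem coeff_partPoly_pow_succ (m j k : ℕ) :
    (partPoly m ^ (j + 1)).coeff k =
      ∑ r ∈ range m, if r + 1 ≤ k then (partPoly m ^ j).coeff (k - (r + 1)) else 0 := by
  rw [pow_succ']
  nth_rw 1 [partPoly]
  simp only [sum_mul, finsetSum_coeff, coeff_X_pow_mul']

theorem coeff_partPoly_pow_pos {m j k : ℕ} (hjk : j ≤ k) (hk : k ≤ j * m) :
    0 < (partPoly m ^ j).coeff k := by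
  induction j generalizing k with
  | zero => simp [show k = 0 by omega]
  | succ j ih =>
    have hm : 0 < m := Nat.pos_of_ne_zero (by rintro rfl; omega)
    have hjm : j ≤ j * m := Nat.le_mul_of_pos_right j hm
    rw [add_one_mul] at hk
    rw [coeff_partPoly_pow_succ]
    refine sum_pos_iff.2 ⟨k - 1 - j * m, mem_range.2 (by omega), ?_⟩
    rw [if_pos (by omega)]
    exact ih (by omega) (by omega)

theorem one_lt_coeff_partPoly_pow {m j k : ℕ} (hj : 2 ≤ j) (hjk : j < k) (hk : k < j * m) :
    1 < (partPoly m ^ j).coeff k := by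
  obtain ⟨j, rfl⟩ := Nat.exists_eq_add_of_le' (show 1 ≤ j by omega)
  have hm : 2 ≤ m := by
    by_contra! h
    exact (hjk.trans hk).not_ge (mul_le_of_le_one_right' (Nat.le_of_lt_succ h))
  have hjm : j * 2 ≤ j * m := Nat.mul_le_mul_left j hm
  rw [add_one_mul] at hk
  set r := k - 1 - j * m
  have hterm : ∀ s ∈ ({r, r + 1} : Finset ℕ),
      1 ≤ if s + 1 ≤ k then (partPoly m ^ j).coeff (k - (s + 1)) else 0 := by
    intro s hs
    rw [mem_insert, mem_singleton] at hs
    rw [if_pos (by omega)]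
    exact coeff_partPoly_pow_pos (by omega) (by omega)
  have hsub : ({r, r + 1} : Finset ℕ) ⊆ range m := by
    simp only [insert_subset_iff, singleton_subset_iff, mem_range]
    omega
  rw [coeff_partPoly_pow_succ]
  calc 1 < #{r, r + 1} := by simp
    _ = ∑ _s ∈ {r, r + 1}, 1 := card_eq_sum_ones _
    _ ≤ ∑ s ∈ {r, r + 1}, if s + 1 ≤ k then (partPoly m ^ j).coeff (k - (s + 1)) else 0 :=
      sum_le_sum hterm
    _ ≤ _ := sum_le_sum_of_subset hsub

theorem coeff_partPoly_pow_lt {m k n : ℕ} (hk : 0 < k) (hm : 0 < m)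
    (h : k + k ⌈/⌉ m < n ∨ n = k + k ⌈/⌉ m ∧ m < k ∧ ¬ m ∣ k) :
    (partPoly m ^ (n - k ⌈/⌉ m)).coeff k < (partPoly m ^ (k ⌈/⌉ m)).coeff k := by
  have hle {b : ℕ} : k ⌈/⌉ m ≤ b ↔ k ≤ m * b := ceilDiv_le_iff_le_mul hm
  have hkc : k ≤ k ⌈/⌉ m * m := by rw [mul_comm]; exact hle.1 le_rfl
  rcases h with h | ⟨rfl, hmk, hdvd⟩
  · rw [coeff_partPoly_pow_eq_zero (by omega)]
    exact coeff_partPoly_pow_pos (hle.2 (Nat.le_mul_of_pos_left k hm)) hkc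
  · have hm2 : 2 ≤ m := by
      by_contra! h
      exact hdvd (by simp [show m = 1 by omega])
    have hone : 1 < k ⌈/⌉ m := by
      rw [← not_le, hle]
      omega
    have hlt : k ⌈/⌉ m < k := by
      have := (hle (b := k - 1)).2 (by nlinarith [Nat.sub_add_cancel hk])
      omega
    rw [Nat.add_sub_cancel]
    exact (coeff_partPoly_pow_self_le_one m k).trans_lt (one_lt_coeff_partPoly_pow hone hlt
      (hkc.lt_of_ne fun h => hdvd ⟨_, h.trans (mul_comm _ _)⟩))

/-! ### The equality case of the Erdős–Ko–Rado theorem -/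

section Circle

variable {n r : ℕ}

/-- The `r` cyclically consecutive points starting at `i`. -/
def arc (r : ℕ) (i : ZMod n) : Finset (ZMod n) := (range r).image fun t : ℕ => i + t

theorem mem_arc {i x : ZMod n} : x ∈ arc r i ↔ ∃ t : ℕ, t < r ∧ i + t = x := by
  simp only [arc, mem_image, mem_range]

theorem card_arc (hr : r ≤ n) (i : ZMod n) : #(arc r i) = r := by
  rw [arc, card_image_of_injOn, card_range]
  intro s hs t ht hst
  exact CharP.natCast_injOn_Iio (ZMod n) n ((mem_range.1 hs).trans_le hr)
    ((mem_range.1 ht).trans_le hr) (add_left_cancel hst)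

theorem disjoint_arc_add {s : ℕ} (i : ZMod n) (hs : r ≤ s) (hn : s + r ≤ n) :
    Disjoint (arc r i) (arc r (i + s)) := by
  simp only [disjoint_left, mem_arc, not_exists, not_and]
  rintro _ ⟨a, ha, rfl⟩ b hb h
  rw [add_assoc, add_right_inj, ← Nat.cast_add] at h
  have := CharP.natCast_injOn_Iio (ZMod n) n (show s + b < n by omega) (show a < n by omega) h
  omega

theorem exists_eq_add_of_not_disjoint_arc {i j : ZMod n} (h : ¬ Disjoint (arc r i) (arc r j)) :
    ∃ t < r, j = i + t ∨ j = i + t - r := by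
  simp only [not_disjoint_iff, mem_arc] at h
  obtain ⟨_, ⟨a, ha, rfl⟩, b, hb, h⟩ := h
  rcases le_or_gt b a with hba | hab
  · refine ⟨a - b, by omega, .inl ?_⟩
    rw [Nat.cast_sub hba]
    linear_combination h
  · refine ⟨r + a - b, by omega, .inr ?_⟩
    rw [Nat.cast_sub (by omega), Nat.cast_add]
    linear_combination h

theorem card_filter_mem_arc [NeZero n] (hr : r ≤ n) (x : ZMod n) : #{i | x ∈ arc r i} = r := by
  refine Eq.trans ?_ (card_arc hr (-x))
  refine card_equiv (Equiv.neg _) fun i => ?_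
  simp only [mem_filter_univ, mem_arc, Equiv.neg_apply]
  refine exists_congr fun t => and_congr_right fun _ => ?_
  constructor <;> intro h <;> linear_combination h

variable {I : Finset (ZMod n)} (hI : ∀ i ∈ I, ∀ j ∈ I, ¬ Disjoint (arc r i) (arc r j))
include hI

theorem subset_biUnion_inter_pair {i : ZMod n} (hi : i ∈ I) :
    I ⊆ (range r).biUnion fun t => I ∩ {i + t, i + t - r} := by
  intro j hj
  obtain ⟨t, ht, h⟩ := exists_eq_add_of_not_disjoint_arc (hI i hi j hj)
  simp only [mem_biUnion, mem_inter, mem_insert, mem_singleton, mem_range]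
  exact ⟨t, ht, hj, h⟩

theorem sub_notMem_of_intersecting_arcs {s : ℕ} (hs : r ≤ s) (hn : s + r ≤ n) {j : ZMod n}
    (hj : j ∈ I) : j - (s : ZMod n) ∉ I := fun h => by
  refine hI _ h _ hj ?_
  simpa only [sub_add_cancel] using disjoint_arc_add (j - (s : ZMod n)) hs hn

theorem card_inter_pair_le_one (hn : 2 * r ≤ n) (j : ZMod n) : #(I ∩ {j, j - r}) ≤ 1 := by
  have hnot : j ∈ I → j - r ∉ I := sub_notMem_of_intersecting_arcs hI le_rfl (by omega)
  rw [card_le_one]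
  simp only [mem_inter, mem_insert, mem_singleton]
  grind

theorem card_le_of_intersecting_arcs (hn : 2 * r ≤ n) : #I ≤ r := by
  rcases I.eq_empty_or_nonempty with rfl | ⟨i, hi⟩
  · exact Nat.zero_le r
  calc #I ≤ _ := card_le_card (subset_biUnion_inter_pair hI hi)
    _ ≤ #(range r) * 1 := card_biUnion_le_card_mul _ _ _ fun t _ => card_inter_pair_le_one hI hn _
    _ = r := by rw [card_range, mul_one]

theorem mem_or_mem_of_card_eq (hn : 2 * r ≤ n) (hcard : #I = r) {i : ZMod n} (hi : i ∈ I) {t : ℕ}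
    (ht : t < r) : i + t ∈ I ∨ i + t - r ∈ I := by
  by_contra! hnot
  have hsub : I ⊆ ((range r).erase t).biUnion fun t => I ∩ {i + t, i + t - r} := by
    intro j hj
    have hj' := subset_biUnion_inter_pair hI hi hj
    simp only [mem_biUnion, mem_inter, mem_insert, mem_singleton, mem_erase] at hj' ⊢
    grind
  have hle : #I ≤ #((range r).erase t) * 1 := (card_le_card hsub).trans
    (card_biUnion_le_card_mul _ _ _ fun t _ => card_inter_pair_le_one hI hn _)
  rw [card_erase_of_mem (mem_range.2 ht), card_range] at hle
  omega

theorem add_mem_of_pred_notMem (hn : 2 * r < n) (hcard : #I = r) {i : ZMod n} (hi : i ∈ I)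
    (hpred : i - 1 ∉ I) {t : ℕ} (ht : t < r) : i + t ∈ I := by
  obtain ⟨d, hd⟩ := Nat.exists_eq_add_of_le (show t + 1 ≤ r from ht)
  induction d generalizing t with
  | zero =>
    refine (mem_or_mem_of_card_eq hI hn.le hcard hi ht).resolve_right ?_
    have hlast : i + t - r = i - 1 := by
      rw [hd]
      push_cast
      ring
    rwa [hlast]
  | succ d ih =>
    have hnext := sub_notMem_of_intersecting_arcs hI (Nat.le_succ r) (by omega)
      (ih (t := t + 1) (by omega) (by omega))
    refine (mem_or_mem_of_card_eq hI hn.le hcard hi ht).resolve_right ?_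
    have hshift : i + t - r = i + (t + 1 : ℕ) - (r + 1 : ℕ) := by
      push_cast
      ring
    rwa [hshift]

end Circle

section Exchange

variable {α : Type*}

theorem exists_mem_disjoint [Fintype α] {D : Finset α} {x : α} {r : ℕ} (hx : x ∉ D) (hr : 1 ≤ r)
    (h : #D + r ≤ Fintype.card α) : ∃ S : Finset α, #S = r ∧ x ∈ S ∧ Disjoint S D := by
  classical
  obtain ⟨S, hxS, hSD, hS⟩ := exists_subsuperset_card_eq (s := {x}) (t := Dᶜ) (n := r)
    (by simpa using hx) (by simpa using hr) (by rw [card_compl]; omega)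
  exact ⟨S, hS, singleton_subset_iff.1 hxS, disjoint_left.2 fun z hz => mem_compl.1 (hSD hz)⟩

theorem exists_perm_map_eq [Finite α] {S S' : Finset α} (h : #S = #S') :
    ∃ τ : Equiv.Perm α, S.map τ.toEmbedding = S' := by
  classical
  have := Fintype.ofFinite α
  let e := equivOfCardEq h
  refine ⟨e.extendSubtype, eq_of_subset_of_card_le (fun x hx => ?_) (by rw [card_map, h])⟩
  obtain ⟨a, ha, rfl⟩ := mem_map.1 hx
  exact e.extendSubtype_mem a ha

theorem exists_equiv_natCast_eq_getElem [Fintype α] {n : ℕ} [NeZero n]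
    (hα : Fintype.card α = n) {l : List α} (hl : l.Nodup) (hmem : ∀ a, a ∈ l) :
    ∃ σ : ZMod n ≃ α, ∀ (t : ℕ) (ht : t < l.length), σ t = l[t] := by
  classical
  obtain rfl : n = l.length := by
    rw [← hα, ← Fintype.card_congr (hl.getEquivOfForallMemList l hmem), Fintype.card_fin]
  let f (i : ZMod l.length) : α := l[i.val]'(ZMod.val_lt i)
  have hf (t : ℕ) (ht : t < l.length) : f t = l[t] := by
    simp only [f, ZMod.val_natCast_of_lt ht]
  have hinj : Function.Injective f := fun i j hij =>
    ZMod.val_injective _ (hl.getElem_inj_iff.1 hij)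
  have hsurj : Function.Surjective f := fun a => by
    obtain ⟨t, ht, rfl⟩ := List.mem_iff_getElem.1 (hmem a)
    exact ⟨t, hf t ht⟩
  exact ⟨Equiv.ofBijective f ⟨hinj, hsurj⟩, hf⟩

variable [DecidableEq α]

theorem exists_mem_exchange_notMem {F : Finset (Finset α)} {A C : Finset α} (hA : A ∈ F)
    (hC : C ∉ F) (hAC : #A = #C) : ∃ A ∈ F, ∃ x ∈ A, ∃ y ∉ A, insert y (A.erase x) ∉ F := by
  obtain ⟨B, hB, hmin⟩ := exists_min_image {B ∈ F | #B = #C} (fun B => #(B \ C))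
    ⟨A, mem_filter.2 ⟨hA, hAC⟩⟩
  obtain ⟨hBF, hBC⟩ := mem_filter.1 hB
  have hne : B ≠ C := ne_of_mem_of_not_mem hBF hC
  obtain ⟨x, hxB, hxC⟩ := not_subset.1 fun h => hne (eq_of_subset_of_card_le h hBC.ge)
  obtain ⟨y, hyC, hyB⟩ := not_subset.1 fun h => hne.symm (eq_of_subset_of_card_le h hBC.le)
  refine ⟨B, hBF, x, hxB, y, hyB, fun hmem => ?_⟩
  have hcard : #(insert y (B.erase x)) = #C := by
    rw [card_insert_of_notMem (by simp [hyB]), card_erase_add_one hxB, hBC]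
  have hcloser : insert y (B.erase x) \ C ⊂ B \ C := by
    rw [ssubset_iff_of_subset (by grind)]
    exact ⟨x, by grind⟩
  exact (hmin _ (mem_filter.2 ⟨hmem, hcard⟩)).not_gt (card_lt_card hcloser)

theorem card_filter_map_eq [Fintype α] {β : Type*} [Fintype β] [DecidableEq β] (T : Finset β)
    {S S' : Finset α} (h : #S = #S') :
    #{σ : β ≃ α | T.map σ.toEmbedding = S} = #{σ : β ≃ α | T.map σ.toEmbedding = S'} := by
  obtain ⟨τ, rfl⟩ := exists_perm_map_eq h
  refine card_equiv ((Equiv.refl β).equivCongr τ) fun σ => ?_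
  have hmap : T.map ((Equiv.refl β).equivCongr τ σ).toEmbedding =
      (T.map σ.toEmbedding).map τ.toEmbedding := by
    rw [map_map]
    rfl
  rw [mem_filter_univ, mem_filter_univ, hmap, map_inj]

/-- The family of all subsets of the ground set that contain `x`. -/
def fullStar [Fintype α] (x : α) : Finset (Finset α) := {S | x ∈ S}

theorem mem_fullStar [Fintype α] {x : α} {S : Finset α} : S ∈ fullStar x ↔ x ∈ S :=
  mem_filter_univ S

theorem card_slice_fullStar [Fintype α] (x : α) {r : ℕ} (hr : 1 ≤ r) :
    #((fullStar x).slice r) = (Fintype.card α - 1).choose (r - 1) := by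
  have hslice : (fullStar x).slice r = {S ∈ (univ : Finset α).powersetCard r | {x} ⊆ S} := by
    ext S
    simp [mem_slice, mem_fullStar, and_comm]
  rw [hslice, card_filter_powersetCard_subset _ _ _ (subset_univ _) (by simpa using hr),
    card_singleton, card_univ]

theorem map_arc_eq_toFinset {n : ℕ} {l L₁ L₂ L₃ : List α} {σ : ZMod n ≃ α}
    (hσ : ∀ (t : ℕ) (ht : t < l.length), σ t = l[t]) (hl : l = L₁ ++ (L₂ ++ L₃)) :
    (arc L₂.length (L₁.length : ZMod n)).map σ.toEmbedding = L₂.toFinset := by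
  subst hl
  have hget (t : ℕ) (ht : t < L₂.length) : σ (L₁.length + t) = L₂[t] := by
    rw [← Nat.cast_add, hσ _ (by simp only [List.length_append]; omega)]
    simp [ht]
  ext a
  simp only [mem_map, mem_arc, List.mem_toFinset, List.mem_iff_getElem, Equiv.coe_toEmbedding]
  constructor
  · rintro ⟨_, ⟨t, ht, rfl⟩, rfl⟩
    exact ⟨t, ht, (hget t ht).symm⟩
  · rintro ⟨t, ht, rfl⟩
    exact ⟨_, ⟨t, ht, rfl⟩, hget t ht⟩

end Exchange

section CircleMethod

variable {α : Type*} [DecidableEq α] {n r : ℕ} [NeZero n]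

/-- The starting points of the arcs of length `r` that are members of `F`, once the ground set has
been placed on a circle by `σ`. -/
def arcStarts (F : Finset (Finset α)) (r : ℕ) (σ : ZMod n ≃ α) : Finset (ZMod n) :=
  {i | (arc r i).map σ.toEmbedding ∈ F}

theorem mem_arcStarts {F : Finset (Finset α)} {σ : ZMod n ≃ α} {i : ZMod n} :
    i ∈ arcStarts F r σ ↔ (arc r i).map σ.toEmbedding ∈ F := mem_filter_univ i

theorem not_disjoint_arc_of_mem_arcStarts {F : Finset (Finset α)}
    (hF : (F : Set (Finset α)).Intersecting) {σ : ZMod n ≃ α} :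
    ∀ i ∈ arcStarts F r σ, ∀ j ∈ arcStarts F r σ, ¬ Disjoint (arc r i) (arc r j) :=
  fun _ hi _ hj h => hF (mem_arcStarts.1 hi) (mem_arcStarts.1 hj) ((disjoint_map _).2 h)

variable [Fintype α]

theorem sum_card_arcStarts_congr {F G : Finset (Finset α)} (hF : (F : Set (Finset α)).Sized r)
    (hG : (G : Set (Finset α)).Sized r) (h : #F = #G) :
    ∑ σ : ZMod n ≃ α, #(arcStarts F r σ) = ∑ σ : ZMod n ≃ α, #(arcStarts G r σ) := by
  have hswap (F : Finset (Finset α)) : ∑ σ : ZMod n ≃ α, #(arcStarts F r σ) =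
      ∑ i : ZMod n, ∑ S ∈ F, #{σ : ZMod n ≃ α | (arc r i).map σ.toEmbedding = S} := by
    simp only [arcStarts, card_filter]
    rw [sum_comm]
    refine sum_congr rfl fun i _ => ?_
    rw [sum_comm]
    exact sum_congr rfl fun σ _ => (sum_ite_eq F _ fun _ => 1).symm
  rw [hswap, hswap]
  refine sum_congr rfl fun i _ => ?_
  rw [← sum_coe_sort F, ← sum_coe_sort G]
  exact Fintype.sum_equiv (equivOfCardEq h) _ _ fun S =>
    card_filter_map_eq _ ((hF S.2).trans (hG (equivOfCardEq h S).2).symm)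

theorem card_arcStarts_fullStar (hr : r ≤ n) (x : α) (σ : ZMod n ≃ α) :
    #(arcStarts ((fullStar x).slice r) r σ) = r := by
  refine Eq.trans ?_ (card_filter_mem_arc hr (σ.symm x))
  congr 1
  ext i
  simp [mem_arcStarts, mem_slice, mem_fullStar, card_arc hr, mem_map_equiv]

theorem card_arcStarts_eq (hr : 1 ≤ r) (hn : 2 * r ≤ n) {F : Finset (Finset α)}
    (hF : (F : Set (Finset α)).Intersecting) (hs : (F : Set (Finset α)).Sized r)
    (hcard : #F = (Fintype.card α - 1).choose (r - 1)) (σ : ZMod n ≃ α) :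
    #(arcStarts F r σ) = r := by
  have hle (σ : ZMod n ≃ α) : #(arcStarts F r σ) ≤ r :=
    card_le_of_intersecting_arcs (not_disjoint_arc_of_mem_arcStarts hF) hn
  have hsum : ∑ σ : ZMod n ≃ α, #(arcStarts F r σ) = ∑ _σ : ZMod n ≃ α, r := by
    rw [sum_card_arcStarts_congr hs sized_slice (hcard.trans (card_slice_fullStar (σ 0) hr).symm)]
    exact sum_congr rfl fun τ _ => card_arcStarts_fullStar (by omega) (σ 0) τ
  exact (sum_eq_sum_iff_of_le fun σ _ => hle σ).1 hsum σ (mem_univ σ)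

theorem exists_equiv_arc_exchange {A S : Finset α} (hα : Fintype.card α = n) (hA : #A = r)
    (hS : #S = r) {x y : α} (hxA : x ∈ A) (hyA : y ∉ A) (hxS : x ∈ S) (hyS : y ∉ S) :
    ∃ σ : ZMod n ≃ α, ∃ p < r, (arc r 0).map σ.toEmbedding = insert y (A.erase x) ∧
      (arc r 1).map σ.toEmbedding = A ∧ (arc r (1 + p : ZMod n)).map σ.toEmbedding = S := by
  -- The circle reads `y`, `A \ S`, `(A ∩ S).erase x`, `x`, `S \ A`, and then all other points.
  let P := (A \ S).toList
  let Q := ((A ∩ S).erase x).toList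
  let R := (S \ A).toList
  let Z := (insert y (A ∪ S))ᶜ.toList
  have hPQ : P.length + Q.length + 1 = r := by
    rw [← hA, ← card_sdiff_add_card_inter A S, ← card_erase_add_one (mem_inter.2 ⟨hxA, hxS⟩)]
    simp only [P, Q, length_toList, add_assoc]
  have hPR : P.length = R.length := by
    simp only [P, R, length_toList, card_sdiff_comm (hA.trans hS.symm)]
  let l := y :: (P ++ (Q ++ (x :: (R ++ Z))))
  have hnodup : l.Nodup := by
    simp only [l, List.nodup_cons, List.nodup_append, List.mem_append, List.mem_cons, P, Q, R, Z,
      mem_toList, mem_sdiff, mem_erase, mem_inter, mem_compl, mem_insert, mem_union,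
      Finset.nodup_toList]
    grind
  have hmem (a : α) : a ∈ l := by
    simp only [l, List.mem_append, List.mem_cons, P, Q, R, Z, mem_toList, mem_sdiff, mem_erase,
      mem_inter, mem_compl, mem_insert, mem_union]
    grind
  obtain ⟨σ, hσ⟩ := exists_equiv_natCast_eq_getElem hα hnodup hmem
  have h₀ := map_arc_eq_toFinset (L₁ := []) (L₂ := y :: (P ++ Q)) (L₃ := x :: (R ++ Z)) hσ
    (by simp [l])
  have h₁ := map_arc_eq_toFinset (L₁ := [y]) (L₂ := P ++ (Q ++ [x])) (L₃ := R ++ Z) hσ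
    (by simp [l])
  have h₂ := map_arc_eq_toFinset (L₁ := y :: P) (L₂ := Q ++ (x :: R)) (L₃ := Z) hσ
    (by simp [l])
  simp only [List.length_cons, List.length_append, List.length_nil, zero_add] at h₀ h₁ h₂
  rw [show P.length + Q.length + 1 = r by omega, Nat.cast_zero] at h₀
  rw [show P.length + (Q.length + 1) = r by omega, Nat.cast_one] at h₁
  rw [show Q.length + (R.length + 1) = r by omega, add_comm, Nat.cast_add, Nat.cast_one] at h₂
  refine ⟨σ, P.length, by omega, h₀.trans ?_, h₁.trans ?_, h₂.trans ?_⟩ <;> ext a <;>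
    simp [P, Q, R] <;> grind

end CircleMethod

section Uniqueness

variable {α : Type*} [Fintype α] [DecidableEq α] {r : ℕ}

/-- On a circle where `insert y (A.erase x)` and `A` are consecutive arcs, the `r` arcs in `F` are
`A` and the next `r - 1`, and `S` can be made one of them. -/
theorem mem_of_exchange (hr : 1 ≤ r) (hn : 2 * r < Fintype.card α) {F : Finset (Finset α)}
    (hF : (F : Set (Finset α)).Intersecting) (hs : (F : Set (Finset α)).Sized r)
    (hcard : #F = (Fintype.card α - 1).choose (r - 1)) {A : Finset α} (hA : A ∈ F) {x y : α}
    (hxA : x ∈ A) (hyA : y ∉ A) (hB : insert y (A.erase x) ∉ F) {S : Finset α} (hS : #S = r)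
    (hxS : x ∈ S) (hyS : y ∉ S) : S ∈ F := by
  have : NeZero (Fintype.card α) := ⟨by omega⟩
  obtain ⟨σ, p, hp, h₀, h₁, h₂⟩ := exists_equiv_arc_exchange rfl (hs hA) hS hxA hyA hxS hyS
  rw [← h₂, ← mem_arcStarts]
  refine add_mem_of_pred_notMem (not_disjoint_arc_of_mem_arcStarts hF) hn
    (card_arcStarts_eq hr hn.le hF hs hcard σ) ?_ ?_ hp
  · rwa [mem_arcStarts, h₁]
  · rwa [sub_self, mem_arcStarts, h₀]

theorem exists_eq_slice_fullStar (hr : 1 ≤ r) (hn : 2 * r < Fintype.card α)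
    {F : Finset (Finset α)} (hF : (F : Set (Finset α)).Intersecting)
    (hs : (F : Set (Finset α)).Sized r) (hcard : #F = (Fintype.card α - 1).choose (r - 1)) :
    ∃ x, F = (fullStar x).slice r := by
  obtain ⟨A, hA⟩ : F.Nonempty := by
    rw [← card_pos, hcard]
    exact Nat.choose_pos (by omega)
  obtain ⟨C, hCA, hC⟩ := exists_subset_card_eq (s := Aᶜ) (n := r) (by rw [card_compl, hs hA]; omega)
  have hCF : C ∉ F := fun h => hF hA h (disjoint_of_subset_right hCA disjoint_compl_right)
  obtain ⟨B, hB, x, hxB, y, hyB, hexch⟩ :=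
    exists_mem_exchange_notMem hA hCF ((hs hA).trans hC.symm)
  have hxF (D : Finset α) (hD : D ∈ F) : x ∈ D := by
    by_contra hxD
    have hxy : x ∉ insert y D := by
      rw [mem_insert, not_or]
      exact ⟨ne_of_mem_of_not_mem hxB hyB, hxD⟩
    obtain ⟨S, hS, hxS, hdisj⟩ := exists_mem_disjoint hxy hr
      ((Nat.add_le_add_right (card_insert_le y D) r).trans (by rw [hs hD]; omega))
    obtain ⟨hyS, hSD⟩ := disjoint_insert_right.1 hdisj
    exact hF (mem_of_exchange hr hn hF hs hcard hB hxB hyB hexch hS hxS hyS) hD hSD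
  refine ⟨x, eq_of_subset_of_card_le (fun D hD => ?_) ?_⟩
  · exact mem_slice.2 ⟨mem_fullStar.2 (hxF D hD), hs hD⟩
  · rw [hcard, card_slice_fullStar x hr]

theorem forall_mem_of_slice_eq {F : Finset (Finset α)}
    (hF : (F : Set (Finset α)).Intersecting) {y : α} (hr : 1 ≤ r)
    (hslice : F.slice r = (fullStar y).slice r) {S : Finset α} (hS : S ∈ F)
    (hcard : #S + r ≤ Fintype.card α) : y ∈ S := by
  by_contra hyS
  obtain ⟨T, hT, hyT, hdisj⟩ := exists_mem_disjoint hyS hr hcard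
  have hTF : T ∈ F.slice r := hslice ▸ mem_slice.2 ⟨mem_fullStar.2 hyT, hT⟩
  exact hF (mem_slice.1 hTF).1 hS hdisj

end Uniqueness

/-! ### Weighted intersecting families -/

section Levels

variable {α : Type*} [Fintype α] [DecidableEq α] {i j : ℕ}

theorem card_slice_add_card_slice (F : Finset (Finset α)) (hij : i + j = Fintype.card α) :
    #(F.slice i) + #(F.slice j) =
      #{S ∈ (univ : Finset α).powersetCard i | S ∈ F} +
        #{S ∈ (univ : Finset α).powersetCard i | Sᶜ ∈ F} := by
  congr 1
  · congr 1
    ext S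
    simp [mem_slice, and_comm]
  · refine card_equiv (compl_involutive.toPerm compl) fun S => ?_
    have := card_le_univ S
    simp only [mem_slice, mem_filter, mem_powersetCard, subset_univ, true_and,
      Function.Involutive.coe_toPerm, compl_compl, card_compl]
    rw [and_comm, and_congr_left_iff]
    omega

theorem card_slice_add_card_slice_le {F : Finset (Finset α)}
    (hF : (F : Set (Finset α)).Intersecting) (hij : i + j = Fintype.card α) (x : α) :
    #(F.slice i) + #(F.slice j) ≤ #((fullStar x).slice i) + #((fullStar x).slice j) := by
  rw [card_slice_add_card_slice F hij, card_slice_add_card_slice (fullStar x) hij]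
  simp only [mem_fullStar, mem_compl]
  rw [card_filter_add_card_filter_not, ← card_union_of_disjoint, ← filter_or]
  · exact card_filter_le _ _
  · exact disjoint_filter.2 fun S _ hS hSc => hF hS hSc disjoint_compl_right

end Levels

theorem mul_add_mul_le_of_add_le_add {a a' b b' v w : ℕ} (hvw : v ≤ w) (ha : a ≤ a')
    (hab : a + b ≤ a' + b') : a * w + b * v ≤ a' * w + b' * v := by
  obtain ⟨d, rfl⟩ := Nat.exists_eq_add_of_le hvw
  nlinarith [Nat.mul_le_mul_right v hab, Nat.mul_le_mul_right d ha]

theorem mul_add_mul_lt_of_add_le_add {a a' b b' v w : ℕ} (hvw : v < w) (ha : a < a')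
    (hab : a + b ≤ a' + b') : a * w + b * v < a' * w + b' * v := by
  obtain ⟨d, rfl⟩ := Nat.exists_eq_add_of_le hvw.le
  nlinarith [Nat.mul_le_mul_right v hab, Nat.mul_lt_mul_of_pos_right ha (show 0 < d by omega)]

section Weighted

variable {n : ℕ} {𝓕 : Finset (Finset (Fin n))} {w : ℕ → ℕ}

theorem two_mul_sum_card (w : ℕ → ℕ) (𝓕 : Finset (Finset (Fin n))) :
    2 * ∑ S ∈ 𝓕, w #S =
      ∑ p ∈ antidiagonal n, (#(𝓕.slice p.1) * w p.1 + #(𝓕.slice p.2) * w p.2) := by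
  have hlevels : ∑ S ∈ 𝓕, w #S = ∑ p ∈ antidiagonal n, #(𝓕.slice p.1) * w p.1 := by
    rw [Nat.sum_antidiagonal_eq_sum_range_succ_mk,
      ← sum_fiberwise_of_maps_to (t := range (n + 1)) (g := card)
        fun S _ => mem_range_succ_iff.2 (card_finset_fin_le S)]
    exact sum_congr rfl fun i _ => sum_const_nat fun S hS => by rw [(mem_filter.1 hS).2]
  have hswap : ∑ p ∈ antidiagonal n, #(𝓕.slice p.2) * w p.2 =
      ∑ p ∈ antidiagonal n, #(𝓕.slice p.1) * w p.1 :=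
    Nat.sum_antidiagonal_swap (f := fun p => #(𝓕.slice p.1) * w p.1)
  rw [sum_add_distrib, hswap, hlevels, two_mul]

variable (h𝓕 : (𝓕 : Set (Finset (Fin n))).Intersecting) (x : Fin n)
include h𝓕

theorem card_slice_le_card_slice_fullStar {i : ℕ} (hi : 2 * i ≤ n) :
    #(𝓕.slice i) ≤ #((fullStar x).slice i) := by
  rcases i.eq_zero_or_pos with rfl | hpos
  · have hempty : 𝓕.slice 0 = ∅ := by
      refine eq_empty_of_forall_notMem fun S hS => ?_
      obtain ⟨hS, hcard⟩ := mem_slice.1 hS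
      exact h𝓕.ne_bot hS (card_eq_zero.1 hcard)
    simp [hempty]
  · rw [card_slice_fullStar x hpos, Fintype.card_fin]
    exact erdos_ko_rado (h𝓕.mono (coe_subset.2 slice_subset)) sized_slice (by omega)

variable (hw : ∀ i j, i ≤ j → i + j = n → w j ≤ w i)
include hw

theorem card_slice_mul_add_le {i j : ℕ} (hij : i + j = n) :
    #(𝓕.slice i) * w i + #(𝓕.slice j) * w j ≤
      #((fullStar x).slice i) * w i + #((fullStar x).slice j) * w j := by
  wlog hle : i ≤ j generalizing i j
  · have := this (i := j) (j := i) (by omega) (by omega)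
    omega
  exact mul_add_mul_le_of_add_le_add (hw i j hle hij)
    (card_slice_le_card_slice_fullStar h𝓕 x (by omega))
    (card_slice_add_card_slice_le h𝓕 (by rw [hij, Fintype.card_fin]) x)

theorem sum_card_le_sum_fullStar : ∑ S ∈ 𝓕, w #S ≤ ∑ S ∈ fullStar x, w #S := by
  refine le_of_mul_le_mul_left ?_ two_pos
  rw [two_mul_sum_card, two_mul_sum_card]
  exact sum_le_sum fun p hp => card_slice_mul_add_le h𝓕 x hw (mem_antidiagonal.1 hp)

theorem card_slice_eq_of_sum_card_eq {c : ℕ} (hc : 2 * c ≤ n) (hlt : w (n - c) < w c)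
    (heq : ∑ S ∈ 𝓕, w #S = ∑ S ∈ fullStar x, w #S) :
    #(𝓕.slice c) = #((fullStar x).slice c) := by
  have hcn : c + (n - c) = n := by omega
  have hpair := (sum_eq_sum_iff_of_le fun p hp =>
    card_slice_mul_add_le h𝓕 x hw (mem_antidiagonal.1 hp)).1
    (by rw [← two_mul_sum_card, ← two_mul_sum_card, heq])
  by_contra hne
  exact (mul_add_mul_lt_of_add_le_add hlt
    ((card_slice_le_card_slice_fullStar h𝓕 x hc).lt_of_ne hne)
    (card_slice_add_card_slice_le h𝓕 (by rw [hcn, Fintype.card_fin]) x)).ne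
    (hpair (c, n - c) (mem_antidiagonal.2 hcn))

end Weighted

/-! ### Multisets and their supports -/

section Support

variable {n : ℕ}

theorem card_filter_toFinset_eq (m k : ℕ) (S : Finset (Fin n)) :
    #{A ∈ kMultisets n m k | A.toFinset = S} = (partPoly m ^ #S).coeff k := by
  have hprod (f : Fin n →₀ ℕ) : ∏ i ∈ S, (partPoly m).coeff (f i) =
      if ∀ i ∈ S, f i ∈ Icc 1 m then 1 else 0 := by
    simp only [coeff_partPoly, prod_boole]
    congr
  rw [← coeff_coe, Polynomial.coe_pow, ← prod_const, PowerSeries.coeff_prod]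
  simp only [coeff_coe, hprod, ← card_filter]
  refine card_equiv (Multiset.toFinsupp (α := Fin n)).toEquiv fun A => ?_
  have hcard : A.toFinset = S → ∑ i ∈ S, A.count i = A.card := by
    rintro rfl
    exact Multiset.toFinset_sum_count_eq A
  simp only [mem_filter, mem_kMultisets, mem_finsuppAntidiag, mem_Icc,
    AddEquiv.toEquiv_eq_coe, EquivLike.coe_coe, Multiset.toFinsupp_apply,
    Multiset.toFinsupp_support, Nat.cast_le, Multiset.one_le_count_iff_mem]
  constructor
  · rintro ⟨⟨hk, hm⟩, rfl⟩
    exact ⟨⟨(hcard rfl).trans hk, Subset.rfl⟩, fun i hi => ⟨Multiset.mem_toFinset.1 hi, hm i⟩⟩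
  · rintro ⟨⟨hk, hsub⟩, hmem⟩
    have hS : A.toFinset = S :=
      hsub.antisymm fun i hi => Multiset.mem_toFinset.2 (hmem i hi).1
    refine ⟨⟨(hcard hS).symm.trans hk, fun i => ?_⟩, hS⟩
    by_cases hi : i ∈ S
    · exact (hmem i hi).2
    · rw [← hS, Multiset.mem_toFinset] at hi
      simp [Multiset.count_eq_zero_of_notMem hi]

theorem card_filter_toFinset_mem (m k : ℕ) (𝓕 : Finset (Finset (Fin n))) :
    #{A ∈ kMultisets n m k | A.toFinset ∈ 𝓕} = ∑ S ∈ 𝓕, (partPoly m ^ #S).coeff k := by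
  have hmaps : ∀ A ∈ ({A ∈ kMultisets n m k | A.toFinset ∈ 𝓕} : Finset _), A.toFinset ∈ 𝓕 :=
    fun A hA => (mem_filter.1 hA).2
  rw [card_eq_sum_card_fiberwise hmaps]
  refine sum_congr rfl fun S hS => ?_
  rw [← card_filter_toFinset_eq, filter_filter]
  congr 1
  exact filter_congr fun A _ => and_iff_right_of_imp fun h => h ▸ hS

theorem intersecting_image_toFinset {𝒜 : Finset (Multiset (Fin n))} (h : IsTIntersecting 1 𝒜) :
    ((𝒜.image Multiset.toFinset : Finset _) : Set (Finset (Fin n))).Intersecting := by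
  rw [coe_image]
  rintro _ ⟨A, hA, rfl⟩ _ ⟨B, hB, rfl⟩ hdisj
  obtain ⟨z, hz⟩ := Multiset.card_pos_iff_exists_mem.1 (h A hA B hB)
  obtain ⟨hzA, hzB⟩ := Multiset.mem_inter.1 hz
  exact disjoint_left.1 hdisj (Multiset.mem_toFinset.2 hzA) (Multiset.mem_toFinset.2 hzB)

end Support

section Star

variable {n : ℕ}

/-- The `k`-multisets of `[n]_m` that contain `x`; for the first element `x` this is `F_{0,1}`. -/
def multisetStar (n : ℕ) (m : ℕ∞) (k : ℕ) (x : Fin n) : Finset (Multiset (Fin n)) :=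
  {A ∈ kMultisets n m k | x ∈ A}

theorem mem_multisetStar {m : ℕ∞} {k : ℕ} {x : Fin n} {A : Multiset (Fin n)} :
    A ∈ multisetStar n m k x ↔ A ∈ kMultisets n m k ∧ x ∈ A := mem_filter

theorem frankl_zero_one [NeZero n] (m : ℕ∞) (k : ℕ) : frankl n m k 0 1 = multisetStar n m k 0 := by
  have hinit : initSeg n 1 = {0} := by
    have h : ({i | i.val < 1} : Finset (Fin n)) = {0} := by
      ext i
      simp
    rw [initSeg, h, singleton_val]
  refine filter_congr fun A _ => ?_
  change 0 < (A ∩ initSeg n 1).card ↔ _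
  simp only [hinit, Multiset.card_pos_iff_exists_mem, Multiset.mem_inter, Multiset.mem_singleton,
    exists_eq_right]

theorem card_multisetStar (m k : ℕ) (x : Fin n) :
    #(multisetStar n m k x) = ∑ S ∈ fullStar x, (partPoly m ^ #S).coeff k := by
  simp only [multisetStar, ← card_filter_toFinset_mem, mem_fullStar, Multiset.mem_toFinset]

theorem map_mem_kMultisets_iff {m : ℕ∞} {k : ℕ} (σ : Equiv.Perm (Fin n)) {A : Multiset (Fin n)} :
    A.map σ ∈ kMultisets n m k ↔ A ∈ kMultisets n m k := by
  simp only [mem_kMultisets, Multiset.card_map, ← σ.forall_congr_right (q := fun i =>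
    ((A.map σ).count i : ℕ∞) ≤ m), Multiset.count_map_eq_count' _ _ σ.injective]

theorem isomorphic_multisetStar (m : ℕ∞) (k : ℕ) (x y : Fin n) :
    Isomorphic (multisetStar n m k x) (multisetStar n m k y) := by
  let σ := Equiv.swap x y
  have hσ : σ x = y := Equiv.swap_apply_left x y
  refine ⟨σ, ?_⟩
  ext A
  obtain ⟨B, rfl⟩ := Multiset.map_surjective_of_surjective σ.surjective A
  rw [(Multiset.map_injective σ.injective).mem_finset_image, mem_multisetStar, mem_multisetStar,
    map_mem_kMultisets_iff, ← hσ, Multiset.mem_map_of_injective σ.injective]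

theorem Isomorphic.card_eq {𝒜₁ 𝒜₂ : Finset (Multiset (Fin n))} (h : Isomorphic 𝒜₁ 𝒜₂) :
    #𝒜₁ = #𝒜₂ := by
  obtain ⟨σ, rfl⟩ := h
  exact (card_image_of_injective _ (Multiset.map_injective σ.injective)).symm

end Star

section Intersecting

variable {n m k c : ℕ} {𝒜 : Finset (Multiset (Fin n))}

theorem card_le_sum_image_toFinset (h𝒜 : 𝒜 ⊆ kMultisets n m k) :
    #𝒜 ≤ ∑ S ∈ 𝒜.image Multiset.toFinset, (partPoly m ^ #S).coeff k := by
  rw [← card_filter_toFinset_mem]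
  exact card_le_card fun A hA => mem_filter.2 ⟨h𝒜 hA, mem_image_of_mem _ hA⟩

theorem card_le_card_multisetStar (hkc : k ≤ c * m) (hn : k + c ≤ n) (h𝒜 : 𝒜 ⊆ kMultisets n m k)
    (hint : IsTIntersecting 1 𝒜) (x : Fin n) : #𝒜 ≤ #(multisetStar n m k x) := by
  rw [card_multisetStar]
  exact (card_le_sum_image_toFinset h𝒜).trans <|
    sum_card_le_sum_fullStar (intersecting_image_toFinset hint) x fun i j hij hijn =>
      coeff_partPoly_pow_le hkc hij (by omega)

theorem exists_subset_multisetStar (hk : 0 < k) (hkc : k ≤ c * m) (hn : k + c ≤ n)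
    (hlt : (partPoly m ^ (n - c)).coeff k < (partPoly m ^ c).coeff k)
    (h𝒜 : 𝒜 ⊆ kMultisets n m k) (hint : IsTIntersecting 1 𝒜) {x : Fin n}
    (heq : #𝒜 = #(multisetStar n m k x)) : ∃ y, 𝒜 ⊆ multisetStar n m k y := by
  have hck : c ≤ k := by
    by_contra! h
    simp [coeff_partPoly_pow_eq_zero h] at hlt
  have hc : 1 ≤ c := Nat.pos_of_ne_zero (by rintro rfl; omega)
  have hcn : 2 * c < n := by
    refine lt_of_le_of_ne (by omega) fun h => hlt.ne ?_
    rw [show n - c = c by omega]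
  set 𝓕 := 𝒜.image Multiset.toFinset
  have h𝓕 : (𝓕 : Set (Finset (Fin n))).Intersecting := intersecting_image_toFinset hint
  have hw (i j : ℕ) (hij : i ≤ j) (hijn : i + j = n) :
      (partPoly m ^ j).coeff k ≤ (partPoly m ^ i).coeff k :=
    coeff_partPoly_pow_le hkc hij (by omega)
  have hsum : ∑ S ∈ 𝓕, (partPoly m ^ #S).coeff k = ∑ S ∈ fullStar x, (partPoly m ^ #S).coeff k :=
    (sum_card_le_sum_fullStar h𝓕 x hw).antisymm
      ((card_multisetStar m k x).ge.trans (heq ▸ card_le_sum_image_toFinset h𝒜))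
  have hlevel := card_slice_eq_of_sum_card_eq h𝓕 x hw hcn.le hlt hsum
  rw [card_slice_fullStar x hc] at hlevel
  obtain ⟨y, hy⟩ := exists_eq_slice_fullStar hc (by rwa [Fintype.card_fin])
    (h𝓕.mono (coe_subset.2 slice_subset)) sized_slice hlevel
  refine ⟨y, fun A hA => mem_multisetStar.2 ⟨h𝒜 hA, ?_⟩⟩
  have hA_card : #A.toFinset ≤ k :=
    (Multiset.toFinset_card_le A).trans_eq (mem_kMultisets.1 (h𝒜 hA)).1
  exact Multiset.mem_toFinset.1 (forall_mem_of_slice_eq h𝓕 hc hy (mem_image_of_mem _ hA)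
    (by rw [Fintype.card_fin]; omega))

end Intersecting

theorem kMultisets_top (n k : ℕ) : kMultisets n ⊤ k = kMultisets n k k := by
  ext A
  simp only [mem_kMultisets, le_top, implies_true, and_true, Nat.cast_le]
  exact ⟨fun h => ⟨h, fun i => h ▸ Multiset.count_le_card i A⟩, fun h => h.1⟩

theorem ceilQuot_natCast (k m : ℕ) : ceilQuot k m = k ⌈/⌉ m := by
  rcases m.eq_zero_or_pos with rfl | hm
  · simp [ceilQuot]
  refine eq_of_forall_ge_iff fun b => ?_
  rw [ceilDiv_le_iff_le_mul hm, ceilQuot, if_neg (ENat.natCast_ne_top m), ENat.toNat_natCast,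
    Nat.ceil_le, div_le_iff₀' (Nat.cast_pos.2 hm)]
  exact_mod_cast Iff.rfl

theorem exists_natCast_bound {k : ℕ} {m : ℕ∞} (hk : 0 < k) (hm : 1 ≤ m) :
    ∃ b : ℕ, 0 < b ∧ ceilQuot k m = k ⌈/⌉ b ∧ (∀ n, kMultisets n m k = kMultisets n b k) ∧
      (m < k → m = b) := by
  induction m using ENat.recTopCoe with
  | top =>
    have hceil : k ⌈/⌉ k = 1 := by
      have h := smul_ceilDiv (β := ℕ) hk 1
      rwa [smul_eq_mul, mul_one] at h
    exact ⟨k, hk, by simp [ceilQuot, hceil], fun n => kMultisets_top n k,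
      fun h => absurd h not_top_lt⟩
  | coe m => exact ⟨m, Nat.one_le_cast.1 hm, ceilQuot_natCast k m, fun _ => rfl, fun _ => rfl⟩

end MultisetEKR

theorem theorem1p5 (k n : ℕ) (m : ℕ∞) (hk : 2 ≤ k) (hm : 1 ≤ m)
    (hn : k + MultisetEKR.ceilQuot k m ≤ n)
    (𝒜 : Finset (Multiset (Fin n))) (h𝒜 : 𝒜 ⊆ MultisetEKR.kMultisets n m k)
    (hint : MultisetEKR.IsTIntersecting 1 𝒜) :
    𝒜.card ≤ (MultisetEKR.frankl n m k 0 1).card ∧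
      ((k + MultisetEKR.ceilQuot k m < n ∨
          (n = k + MultisetEKR.ceilQuot k m ∧ m < (k : ℕ∞) ∧ ¬ m ∣ (k : ℕ∞))) →
        (𝒜.card = (MultisetEKR.frankl n m k 0 1).card ↔
          MultisetEKR.Isomorphic 𝒜 (MultisetEKR.frankl n m k 0 1))) := by
  open MultisetEKR in
  have hk0 : 0 < k := by omega
  have : NeZero n := ⟨by omega⟩
  obtain ⟨b, hb, hceil, hset, hfin⟩ := exists_natCast_bound hk0 hm
  have hfrankl : frankl n m k 0 1 = multisetStar n b k 0 := by
    rw [frankl_zero_one, multisetStar, multisetStar, hset]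
  rw [hset] at h𝒜
  rw [hceil] at hn ⊢
  rw [hfrankl]
  have hkc : k ≤ k ⌈/⌉ b * b := (le_smul_ceilDiv hb).trans_eq (mul_comm _ _)
  refine ⟨card_le_card_multisetStar hkc hn h𝒜 hint 0, fun h => ⟨fun heq => ?_, Isomorphic.card_eq⟩⟩
  have hlt := coeff_partPoly_pow_lt hk0 hb <| h.imp_right fun ⟨hnk, hmk, hdvd⟩ => by
    obtain rfl := hfin hmk
    exact ⟨hnk, Nat.cast_lt.1 hmk, mt Nat.cast_dvd_cast hdvd⟩
  obtain ⟨y, hy⟩ := exists_subset_multisetStar hk0 hkc hn hlt h𝒜 hint heq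
  have h𝒜_eq : 𝒜 = multisetStar n b k y :=
    eq_of_subset_of_card_le hy ((isomorphic_multisetStar b k y 0).card_eq.trans heq.symm).le
  exact h𝒜_eq ▸ isomorphic_multisetStar b k y 0
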